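/- An Orlicz function is an even convex function $N:\mathbb R\to[0,\infty)$ with $N(u)=0\iff u=0$, strictly increasing on $[0,\infty)$. For measurable $f:\mathbb R\to\mathbb R$ put $\|f\|_{L(N)}=\inf\{k>0:\int_{\mathbb R}N(|f(x)|/k)\,dx\le 1\}$ (with $\inf\emptyset=\infty$), and let $L(N)$ be the space of measurable $f$ with $\|f\|_{L(N)}<\infty$. Let $W_1(L(N))$ be the space of locally absolutely continuous $y:\mathbb R\to\mathbb R$ with $\|y\|_{W_1(L(N))}=\|y'\|_{L(N)}+\|y\|_{L(N)}<\infty$. Assume that $N$ is an Orlicz function of one of the following two kinds. (A) $N\in\Delta$: there is $k<\infty$ with $N(2u)/N(u)<k$ for all $u>0$, and there is $l>1$ with $N(2u)\le N(lu)/(2l)$ for all $u>0$. (B) $N=\exp_\alpha\varphi$ is an exponential Orlicz function: there are $\alpha\ge1$, constants $C_1\ge1$, $C_2>0$ and a continuous $\varphi:[1,\infty)\to\mathbb R$ such that $h(y)=\varphi(e^y)$ is strictly increasing and convex on $[0,\infty)$, $\sum_{k\ge3}e^{h(k)-h(k+1)}<\infty$, and $N(u)=C_2|u|^\alpha$ for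 $|u|\le C_1$, $N(u)=e^{\varphi(|u|)}$ for $|u|>C_1$. Let $0<m\le M<\infty$. Then there is a constant $C=C(m,M,N)\in(0,\infty)$ such that for every $q:\mathbb R\to\mathbb R$ with $q(0)=0$, $$\inf_{x\ne z}\frac{|q(x)-q(z)|}{|x-z|}=m,\qquad \sup_{x\ne z}\frac{|q(x)-q(z)|}{|x-z|}=M,$$ the equation $y'-q(y)=g$ on $\mathbb R$ is Lipschitz correctly solvable from $L(N)$ into $W_1(L(N))$: for every $g\in L(N)$ there is a locally absolutely continuous solution $y=Q[g]\in W_1(L(N))$ (the equation holding almost everywhere), it is the only locally absolutely continuous solution in $L(N)$, and for all $g,g_1,g_2\in L(N)$ $$\|Q[g]\|_{W_1(L(N))}\le C\|g\|_{L(N)},\qquad \|Q[g_1]-Q[g_2]\|_{W_1(L(N))}\le C\|g_1-g_2\|_{L(N)}.$$ -/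

import Mathlib

open MeasureTheory Set
open scoped ENNReal

noncomputable section

/-- Orlicz functions: even, convex, nonnegative, vanishing only at `0`, strictly increasing on
`[0, ∞)`. Continuity follows from convexity on the whole line. -/
structure IsOrliczFunction (N : ℝ → ℝ) : Prop where
  even : ∀ u, N (-u) = N u
  convex : ConvexOn ℝ univ N
  nonneg : ∀ u, 0 ≤ N u
  eq_zero_iff : ∀ u, N u = 0 ↔ u = 0
  strictMono : StrictMonoOn N (Ici 0)

/-- The Luxemburg norm `inf {k > 0 : ∫ N(|f| / k) dx ≤ 1}` on the real line with Lebesgue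
measure, with value `∞` when there is no such `k`. -/
def orliczNorm (N : ℝ → ℝ) (f : ℝ → ℝ) : ℝ≥0∞ :=
  ⨅ (k : ℝ) (_ : 0 < k) (_ : ∫⁻ x, ENNReal.ofReal (N (|f x| / k)) ≤ 1), ENNReal.ofReal k

/-- Membership in the Orlicz space `L(N)`. -/
def MemOrlicz (N : ℝ → ℝ) (f : ℝ → ℝ) : Prop :=
  AEMeasurable f volume ∧ orliczNorm N f < ∞

/-- Local absolute continuity on the line (absolute continuity on every compact interval). -/
def LocallyAC (y : ℝ → ℝ) : Prop :=
  ∀ a b : ℝ, AbsolutelyContinuousOnInterval y a b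

/-- The Orlicz–Sobolev norm `‖y'‖ + ‖y‖` of order one. -/
def orliczSobolevNorm (N : ℝ → ℝ) (y : ℝ → ℝ) : ℝ≥0∞ :=
  orliczNorm N (deriv y) + orliczNorm N y

/-- Membership in the Orlicz–Sobolev space `W₁(L(N))`, whose elements are represented by their
locally absolutely continuous versions; the a.e. derivative is then the weak derivative. -/
def MemOrliczSobolev (N : ℝ → ℝ) (y : ℝ → ℝ) : Prop :=
  LocallyAC y ∧ orliczSobolevNorm N y < ∞

/-- The condition `Δ₂`, for all arguments. -/
def DeltaTwo (N : ℝ → ℝ) : Prop :=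
  ∃ k : ℝ, ∀ u > 0, N (2 * u) / N u < k

/-- The condition `∇₂`, for all arguments. -/
def NablaTwo (N : ℝ → ℝ) : Prop :=
  ∃ l : ℝ, 1 < l ∧ ∀ u > 0, N (2 * u) ≤ N (l * u) / (2 * l)

/-- The class `Δ = Δ₂ ∩ ∇₂` of Orlicz functions. -/
structure IsDeltaClass (N : ℝ → ℝ) : Prop where
  orlicz : IsOrliczFunction N
  delta : DeltaTwo N
  nabla : NablaTwo N

/-- The class `Φ`; only the values of `φ` on `[1, ∞)` matter. Here `h(y) = φ(exp y)`. -/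
structure IsPhi (φ : ℝ → ℝ) : Prop where
  cont : ContinuousOn φ (Ici 1)
  strictMono : StrictMonoOn (fun y => φ (Real.exp y)) (Ici 0)
  convex : ConvexOn ℝ (Ici 0) (fun y => φ (Real.exp y))
  summable : Summable fun k : ℕ =>
    Real.exp (φ (Real.exp ((k : ℝ) + 3)) - φ (Real.exp ((k : ℝ) + 4)))

/-- The even function equal to `C₂ |u|^α` for `|u| ≤ C₁` and to `exp φ(|u|)` for `|u| > C₁`. -/
def expOrlicz (α : ℝ) (φ : ℝ → ℝ) (C₁ C₂ : ℝ) (u : ℝ) : ℝ :=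
  if |u| ≤ C₁ then C₂ * |u| ^ α else Real.exp (φ |u|)

/-- `N = exp_α φ` is an exponential Orlicz function: `α ≥ 1`, `φ ∈ Φ`, and the constants are
chosen so that the resulting function is an Orlicz function (in particular continuous).
The gluing point satisfies `C₁ ≥ 1` because `φ` lives on `[1, ∞)`. -/
def IsExponentialOrlicz (N : ℝ → ℝ) : Prop :=
  IsOrliczFunction N ∧ ∃ (α : ℝ) (φ : ℝ → ℝ) (C₁ C₂ : ℝ),
    1 ≤ α ∧ IsPhi φ ∧ 1 ≤ C₁ ∧ 0 < C₂ ∧ N = expOrlicz α φ C₁ C₂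

/-- The set of all slopes `|q(x) - q(z)| / |x - z|`, `x ≠ z`. -/
def slopes (q : ℝ → ℝ) : Set ℝ :=
  {r | ∃ x z : ℝ, x ≠ z ∧ r = |q x - q z| / |x - z|}

/-- `y` is a (Carathéodory) solution on the whole line of `y' - q(y) = g`. -/
def IsSolution (q g y : ℝ → ℝ) : Prop :=
  LocallyAC y ∧ ∀ᵐ x, deriv y x - q (y x) = g x

/-- The equation `y' - q(y) = g` is Lipschitz correctly solvable from `L(N)` into `W₁(L(N))`
with constant `C`: for each `g` in `L(N)` there is a solution in `W₁(L(N))`, it is the only solution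
in `L(N)` (hence the only one in `W₁(L(N))`), and the two norm bounds hold. -/
structure LipschitzCorrectlySolvable (q N : ℝ → ℝ) (C : ℝ) : Prop where
  existsUnique : ∀ g, MemOrlicz N g → ∃ y, IsSolution q g y ∧ MemOrliczSobolev N y ∧
    ∀ z, IsSolution q g z → MemOrlicz N z → z = y
  bound : ∀ g y, MemOrlicz N g → IsSolution q g y → MemOrliczSobolev N y →
    orliczSobolevNorm N y ≤ ENNReal.ofReal C * orliczNorm N g
  lipschitz : ∀ g₁ g₂ y₁ y₂, MemOrlicz N g₁ → MemOrlicz N g₂ →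
    IsSolution q g₁ y₁ → MemOrliczSobolev N y₁ → IsSolution q g₂ y₂ → MemOrliczSobolev N y₂ →
    orliczSobolevNorm N (y₁ - y₂) ≤ ENNReal.ofReal C * orliczNorm N (g₁ - g₂)

end

/-! Since `0 < m` and `q` is continuous and injective, `q` is strictly monotone, and the reflection
`x ↦ -x` exchanges the increasing and decreasing cases. Let `q` be increasing. Solutions then
separate exponentially to the right, so a bounded one is determined by the future of `g`.

Stability: if `w = y₁ - y₂` and `G = g₁ - g₂`, then `|w|' ≥ m |w| - |G|` almost everywhere.
Integrating `e^{-ms} |w|` over `[x, ∞)` bounds `m |w x|` by the average of `|G (x + s)|` over an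
exponential variable `s` of rate `m` (`IsSolution.mul_abs_sub_le_of_bounded`). By Jensen and
translation invariance such averages do not increase the modular (`lintegral_modular_average_le`),
so `‖w‖ ≤ ‖G‖ / m`; the equation then controls `w'`.

Existence: write `q u = M u + p u`, where `p` is `(M - m)`-Lipschitz. Inverting `y' - M y` on
bounded functions gives a contraction of ratio `1 - m / M` (`exists_bounded_solution`).

Uniqueness: a solution in `L(N)` is small at points arbitrarily far right, and the same integral
inequality carries this back to a global bound (`IsSolution.exists_bound`). -/

/-! ### The exponential kernel -/

/-- The exponential distribution of rate `m`, with density `m e^{-ms}` on the positive half-line. -/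
noncomputable def expDecay (m : ℝ) : Measure ℝ :=
  (volume.restrict (Ioi 0)).withDensity fun s => ENNReal.ofReal (m * Real.exp (-(m * s)))

lemma integrableOn_exp_neg_mul_Ioi {m : ℝ} (hm : 0 < m) (c : ℝ) :
    IntegrableOn (fun s => Real.exp (-(m * s))) (Ioi c) := by
  simpa [neg_mul] using integrableOn_exp_mul_Ioi (neg_lt_zero.mpr hm) c

lemma isProbabilityMeasure_expDecay {m : ℝ} (hm : 0 < m) :
    IsProbabilityMeasure (expDecay m) := by
  constructor
  rw [expDecay, withDensity_apply _ MeasurableSet.univ, Measure.restrict_univ,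
    ← ofReal_integral_eq_lintegral_ofReal ((integrableOn_exp_neg_mul_Ioi hm 0).const_mul m)
      (Filter.Eventually.of_forall fun s => by positivity)]
  have h := integral_exp_mul_Ioi (neg_lt_zero.mpr hm) 0
  simp only [neg_mul, mul_zero, Real.exp_zero] at h
  rw [integral_const_mul, h]
  simp [hm.ne']

lemma expDecay_absolutelyContinuous (m : ℝ) : expDecay m ≪ volume :=
  (withDensity_absolutelyContinuous _ _).trans Measure.absolutelyContinuous_restrict

lemma lintegral_expDecay_le {m : ℝ} (hm : 0 < m) (f : ℝ → ℝ≥0∞) :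
    ∫⁻ s, f s ∂expDecay m ≤ ENNReal.ofReal m * ∫⁻ s, f s := by
  rw [expDecay, lintegral_withDensity_eq_lintegral_mul_non_measurable _ (by fun_prop)
    (Filter.Eventually.of_forall fun s => ENNReal.ofReal_lt_top)]
  rw [← lintegral_const_mul' _ _ ENNReal.ofReal_ne_top]
  refine (setLIntegral_mono' measurableSet_Ioi fun s hs => ?_).trans
    (setLIntegral_le_lintegral (Ioi 0) _)
  simp only [Pi.mul_apply]
  gcongr
  refine mul_le_of_le_one_right hm.le (Real.exp_le_one_iff.mpr ?_)
  have := mul_pos hm hs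
  linarith

lemma preimage_add_left_Ioi_self (x : ℝ) : (fun s => x + s) ⁻¹' Ioi x = Ioi 0 := by
  ext s; simp

/-- The substitution `s ↦ s - x` moves `x` out of the integrand into the prefactor and the endpoint,
where it can be differentiated without regularity of `f`. -/
lemma integral_expDecay_translate {m : ℝ} (hm : 0 < m) (f : ℝ → ℝ) (x : ℝ) :
    ∫ s, f (x + s) ∂expDecay m =
      m * Real.exp (m * x) * ∫ s in Ioi x, Real.exp (-(m * s)) * f s := by
  rw [expDecay, integral_withDensity_eq_integral_toReal_smul (by fun_prop)
    (Filter.Eventually.of_forall fun s => ENNReal.ofReal_lt_top),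
    ← (measurePreserving_add_left volume x).setIntegral_preimage_emb
      (measurableEmbedding_addLeft x) _ (Ioi x), preimage_add_left_Ioi_self, ← integral_const_mul]
  refine integral_congr_ae (Filter.Eventually.of_forall fun s => ?_)
  simp only [smul_eq_mul]
  rw [ENNReal.toReal_ofReal (by positivity), mul_add, neg_add, Real.exp_add, Real.exp_neg (m * x)]
  field_simp

lemma integrableOn_of_integrable_expDecay_translate {m : ℝ} (hm : 0 < m) {f : ℝ → ℝ} {x : ℝ}
    (hf : Integrable (fun s => f (x + s)) (expDecay m)) :
    IntegrableOn (fun s => Real.exp (-(m * s)) * f s) (Ioi x) := by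
  rw [expDecay, integrable_withDensity_iff_integrable_smul' (by fun_prop)
    (Filter.Eventually.of_forall fun s => ENNReal.ofReal_lt_top)] at hf
  rw [← (measurePreserving_add_left volume x).integrableOn_comp_preimage
    (measurableEmbedding_addLeft x), preimage_add_left_Ioi_self]
  refine (hf.const_mul (m⁻¹ * Real.exp (-(m * x)))).congr
    (Filter.Eventually.of_forall fun s => ?_)
  simp only [smul_eq_mul, Function.comp_apply]
  rw [ENNReal.toReal_ofReal (by positivity), mul_add, neg_add, Real.exp_add]
  field_simp

/-! ### Elementary properties of Orlicz functions -/

namespace IsOrliczFunction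

variable {N : ℝ → ℝ}

lemma continuous (hN : IsOrliczFunction N) : Continuous N :=
  continuousOn_univ.mp (hN.convex.continuousOn isOpen_univ)

lemma map_zero (hN : IsOrliczFunction N) : N 0 = 0 := (hN.eq_zero_iff 0).mpr rfl

lemma mono (hN : IsOrliczFunction N) {u v : ℝ} (hu : 0 ≤ u) (huv : u ≤ v) : N u ≤ N v :=
  hN.strictMono.monotoneOn hu (hu.trans huv) huv

lemma pos (hN : IsOrliczFunction N) {u : ℝ} (hu : 0 < u) : 0 < N u :=
  lt_of_le_of_ne (hN.nonneg u) fun h => hu.ne' ((hN.eq_zero_iff u).mp h.symm)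

/-- Convexity and `N 0 = 0` force at least linear growth beyond `1`. This makes functions in `L(N)`
integrable against the exponential kernel, uniformly over translates. -/
lemma le_one_add (hN : IsOrliczFunction N) {u : ℝ} (hu : 0 ≤ u) : u ≤ 1 + (N 1)⁻¹ * N u := by
  have h1 := hN.pos one_pos
  rcases le_total u 1 with h | h
  · have := mul_nonneg (inv_nonneg.mpr h1.le) (hN.nonneg u)
    linarith
  · have hu0 : 0 < u := by linarith
    have hc := hN.convex.2 (mem_univ u) (mem_univ 0) (inv_nonneg.mpr hu)
      (sub_nonneg.mpr (inv_le_one_of_one_le₀ h)) (add_sub_cancel _ _)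
    simp only [smul_eq_mul, mul_zero, add_zero, hN.map_zero, inv_mul_cancel₀ hu0.ne'] at hc
    have : u ≤ (N 1)⁻¹ * N u := by
      rw [inv_mul_eq_div, le_div_iff₀ h1]
      calc u * N 1 ≤ u * (u⁻¹ * N u) := by gcongr
        _ = N u := by field_simp
    linarith

end IsOrliczFunction

/-! ### Modulars, exponential averages and the Luxemburg norm -/

section Modular

variable {N : ℝ → ℝ} {g : ℝ → ℝ} {k m : ℝ}

lemma aemeasurable_translate_expDecay (hg : AEMeasurable g) (x : ℝ) :
    AEMeasurable (fun s => g (x + s)) (expDecay m) :=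
  (hg.comp_quasiMeasurePreserving
    (measurePreserving_add_left volume x).quasiMeasurePreserving).mono_ac
    (expDecay_absolutelyContinuous m)

lemma lintegral_modular_translate_le (hm : 0 < m)
    (hk : ∫⁻ x, ENNReal.ofReal (N (|g x| / k)) ≤ 1) (x : ℝ) :
    ∫⁻ s, ENNReal.ofReal (N (|g (x + s)| / k)) ∂expDecay m ≤ ENNReal.ofReal m := by
  refine (lintegral_expDecay_le hm _).trans ?_
  rw [lintegral_add_left_eq_self (fun s => ENNReal.ofReal (N (|g s| / k))) x]
  exact mul_le_of_le_one_right' hk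

lemma integrable_modular_translate (hN : IsOrliczFunction N) (hm : 0 < m) (hg : AEMeasurable g)
    (hk : ∫⁻ x, ENNReal.ofReal (N (|g x| / k)) ≤ 1) (x : ℝ) :
    Integrable (fun s => N (|g (x + s)| / k)) (expDecay m) := by
  refine ⟨(hN.continuous.measurable.comp_aemeasurable
    ((aemeasurable_translate_expDecay hg x).abs.div_const k)).aestronglyMeasurable, ?_⟩
  rw [hasFiniteIntegral_iff_ofReal (Filter.Eventually.of_forall fun s => hN.nonneg _)]
  exact (lintegral_modular_translate_le hm hk x).trans_lt ENNReal.ofReal_lt_top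

lemma integral_modular_translate_le (hN : IsOrliczFunction N) (hm : 0 < m) (hg : AEMeasurable g)
    (hk : ∫⁻ x, ENNReal.ofReal (N (|g x| / k)) ≤ 1) (x : ℝ) :
    ∫ s, N (|g (x + s)| / k) ∂expDecay m ≤ m := by
  rw [integral_eq_lintegral_of_nonneg_ae (Filter.Eventually.of_forall fun s => hN.nonneg _)
    (integrable_modular_translate hN hm hg hk x).aestronglyMeasurable]
  exact ENNReal.toReal_le_of_le_ofReal hm.le (lintegral_modular_translate_le hm hk x)

lemma abs_le_of_modular (hN : IsOrliczFunction N) (hk0 : 0 < k) (u : ℝ) :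
    |u| ≤ k + k * (N 1)⁻¹ * N (|u| / k) := by
  have h := mul_le_mul_of_nonneg_left (hN.le_one_add (div_nonneg (abs_nonneg u) hk0.le)) hk0.le
  rw [mul_div_cancel₀ _ hk0.ne'] at h
  linarith

lemma integrable_translate (hN : IsOrliczFunction N) (hm : 0 < m) (hg : AEMeasurable g)
    (hk0 : 0 < k) (hk : ∫⁻ x, ENNReal.ofReal (N (|g x| / k)) ≤ 1) (x : ℝ) :
    Integrable (fun s => g (x + s)) (expDecay m) := by
  have := isProbabilityMeasure_expDecay hm
  refine Integrable.mono' ((integrable_const k).add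
    ((integrable_modular_translate hN hm hg hk x).const_mul (k * (N 1)⁻¹)))
    (aemeasurable_translate_expDecay hg x).aestronglyMeasurable
    (Filter.Eventually.of_forall fun s => abs_le_of_modular hN hk0 _)

lemma integral_abs_translate_le (hN : IsOrliczFunction N) (hm : 0 < m) (hg : AEMeasurable g)
    (hk0 : 0 < k) (hk : ∫⁻ x, ENNReal.ofReal (N (|g x| / k)) ≤ 1) (x : ℝ) :
    ∫ s, |g (x + s)| ∂expDecay m ≤ k + k * (N 1)⁻¹ * m := by
  have := isProbabilityMeasure_expDecay hm
  have hi := (integrable_modular_translate hN hm hg hk x).const_mul (k * (N 1)⁻¹)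
  refine (integral_mono (integrable_translate hN hm hg hk0 hk x).abs
    ((integrable_const k).add hi) fun s => abs_le_of_modular hN hk0 _).trans ?_
  simp only [Pi.add_apply]
  rw [integral_add (integrable_const k) hi, integral_const_mul]
  have h1 := hN.pos one_pos
  have := integral_modular_translate_le hN hm hg hk x
  simp only [integral_const, probReal_univ, one_smul]
  gcongr

/-- Averaging over translates does not increase the modular, by Jensen's inequality. -/
lemma lintegral_modular_average_le (hN : IsOrliczFunction N) (hm : 0 < m) (hg : AEMeasurable g)
    (hk0 : 0 < k) (hk : ∫⁻ x, ENNReal.ofReal (N (|g x| / k)) ≤ 1) :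
    ∫⁻ x, ENNReal.ofReal (N ((∫ s, |g (x + s)| ∂expDecay m) / k)) ≤ 1 := by
  have := isProbabilityMeasure_expDecay hm
  have hjensen (x : ℝ) : ENNReal.ofReal (N ((∫ s, |g (x + s)| ∂expDecay m) / k)) ≤
      ∫⁻ s, ENNReal.ofReal (N (|hg.mk g (x + s)| / k)) ∂expDecay m := by
    -- `g` is only a.e. measurable; its measurable representative makes the integrand jointly
    -- measurable in `(x, s)`, as the Tonelli swap below requires.
    have hae : ∀ᵐ s ∂expDecay m, g (x + s) = hg.mk g (x + s) :=
      (expDecay_absolutelyContinuous m).ae_le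
        ((measurePreserving_add_left volume x).quasiMeasurePreserving.ae hg.ae_eq_mk)
    rw [← integral_div]
    have hi := integrable_modular_translate hN hm hg hk x
    refine (ENNReal.ofReal_le_ofReal (hN.convex.map_integral_le hN.continuous.continuousOn
      isClosed_univ (Filter.Eventually.of_forall fun s => mem_univ _)
      ((integrable_translate hN hm hg hk0 hk x).abs.div_const k) hi)).trans ?_
    rw [ofReal_integral_eq_lintegral_ofReal hi
      (Filter.Eventually.of_forall fun s => hN.nonneg _)]
    refine (lintegral_congr_ae ?_).le
    filter_upwards [hae] with s hs
    rw [hs]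
  have hmeas : Measurable fun u => ENNReal.ofReal (N (|hg.mk g u| / k)) :=
    (hN.continuous.measurable.comp (hg.measurable_mk.abs.div_const k)).ennreal_ofReal
  calc _ ≤ ∫⁻ x, ∫⁻ s, ENNReal.ofReal (N (|hg.mk g (x + s)| / k)) ∂expDecay m :=
        lintegral_mono hjensen
    _ = ∫⁻ s, (∫⁻ x, ENNReal.ofReal (N (|hg.mk g (x + s)| / k))) ∂expDecay m := by
        refine lintegral_lintegral_swap (Measurable.aemeasurable ?_)
        exact hmeas.comp (measurable_fst.add measurable_snd)
    _ = ∫⁻ _, (∫⁻ x, ENNReal.ofReal (N (|hg.mk g x| / k))) ∂expDecay m := by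
        congr! 2 with s
        exact lintegral_add_right_eq_self (fun x => ENNReal.ofReal (N (|hg.mk g x| / k))) s
    _ = ∫⁻ x, ENNReal.ofReal (N (|hg.mk g x| / k)) := by simp
    _ = ∫⁻ x, ENNReal.ofReal (N (|g x| / k)) := by
        refine lintegral_congr_ae ?_
        filter_upwards [hg.ae_eq_mk] with x hx
        rw [hx]
    _ ≤ 1 := hk

lemma exists_modular_le_one {f : ℝ → ℝ} (hf : orliczNorm N f < ∞) :
    ∃ k : ℝ, 0 < k ∧ ∫⁻ x, ENNReal.ofReal (N (|f x| / k)) ≤ 1 := by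
  simp only [orliczNorm, iInf_lt_iff] at hf
  obtain ⟨k, hk, hk', -⟩ := hf
  exact ⟨k, hk, hk'⟩

lemma orliczNorm_le {f : ℝ → ℝ} (hk0 : 0 < k)
    (hk : ∫⁻ x, ENNReal.ofReal (N (|f x| / k)) ≤ 1) : orliczNorm N f ≤ ENNReal.ofReal k :=
  (iInf_le _ k).trans ((iInf_le _ hk0).trans (iInf_le _ hk))

lemma le_mul_orliczNorm {C : ℝ} (hC : 0 < C) {f : ℝ → ℝ} {A : ℝ≥0∞}
    (h : ∀ k : ℝ, 0 < k → ∫⁻ x, ENNReal.ofReal (N (|f x| / k)) ≤ 1 →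
      A ≤ ENNReal.ofReal (C * k)) : A ≤ ENNReal.ofReal C * orliczNorm N f := by
  have hC' : ENNReal.ofReal C ≠ 0 := by simpa using hC
  simp only [orliczNorm]
  rw [← ENNReal.div_le_iff' hC' ENNReal.ofReal_ne_top]
  refine le_iInf fun k => le_iInf fun hk => le_iInf fun hk' => ?_
  rw [ENNReal.div_le_iff' hC' ENNReal.ofReal_ne_top, ← ENNReal.ofReal_mul hC.le]
  exact h k hk hk'

/-- A function in the Orlicz space takes values of modulus at most `1` arbitrarily far out. -/
lemma exists_abs_le_one (hN : IsOrliczFunction N) {f : ℝ → ℝ} (hf : orliczNorm N f < ∞) (x : ℝ) :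
    ∃ t, x ≤ t ∧ |f t| ≤ 1 := by
  obtain ⟨k, hk0, hk⟩ := exists_modular_le_one hf
  by_contra! h
  -- If `|f| > 1` on a whole half-line, the modular is at least `N k⁻¹` times infinite measure.
  have hpos := hN.pos (inv_pos.mpr hk0)
  have h1 : ∫⁻ _ in Ici x, ENNReal.ofReal (N k⁻¹) ≤ 1 := by
    refine ((setLIntegral_mono' measurableSet_Ici fun t ht => ?_).trans
      (setLIntegral_le_lintegral _ _)).trans hk
    refine ENNReal.ofReal_le_ofReal (hN.mono (inv_pos.mpr hk0).le ?_)
    rw [inv_eq_one_div]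
    gcongr
    exact (h t ht).le
  rw [setLIntegral_const, Real.volume_Ici, ENNReal.mul_top (by simpa using hpos)] at h1
  exact absurd h1 (by simp)

end Modular

/-! ### Calculus of locally absolutely continuous functions -/

namespace LocallyAC

variable {y z : ℝ → ℝ}

lemma continuous (hy : LocallyAC y) : Continuous y := by
  refine continuous_iff_continuousAt.mpr fun x => ?_
  refine (hy (x - 1) (x + 1)).continuousOn.continuousAt ?_
  rw [uIcc_of_le (by linarith)]
  exact Icc_mem_nhds (by linarith) (by linarith)

lemma ae_differentiableAt (hy : LocallyAC y) : ∀ᵐ x, DifferentiableAt ℝ y x := by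
  have h : ∀ᵐ x, ∀ n : ℕ, x ∈ uIcc (-(n : ℝ)) n → DifferentiableAt ℝ y x :=
    ae_all_iff.mpr fun n => (hy _ _).ae_differentiableAt
  filter_upwards [h] with x hx
  obtain ⟨n, hn⟩ := exists_nat_ge |x|
  refine hx n ?_
  rw [uIcc_of_le (by linarith [abs_nonneg x])]
  exact abs_le.mp hn

lemma sub (hy : LocallyAC y) (hz : LocallyAC z) : LocallyAC (y - z) :=
  fun a b => (hy a b).sub (hz a b)

lemma mul (hy : LocallyAC y) (hz : LocallyAC z) : LocallyAC fun x => y x * z x :=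
  fun a b => (hy a b).fun_mul (hz a b)

lemma abs (hy : LocallyAC y) : LocallyAC fun x => |y x| := by
  intro a b
  refine squeeze_zero (fun E => Finset.sum_nonneg fun i _ => dist_nonneg)
    (fun E => Finset.sum_le_sum fun i _ => ?_) (hy a b)
  simp only [Real.dist_eq]
  exact abs_abs_sub_abs_le _ _

lemma _root_.ContDiff.locallyAC (hy : ContDiff ℝ 1 y) : LocallyAC y :=
  fun _ _ => hy.contDiffOn.absolutelyContinuousOnInterval

lemma integral {f : ℝ → ℝ} (hf : ∀ a b, IntervalIntegrable f volume a b) (c : ℝ) :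
    LocallyAC fun x => ∫ s in c..x, f s := by
  intro a b
  -- The interval is enlarged to contain the base point `c`, then restricted back.
  refine ((hf (min (min a b) c) (max (max a b) c)).absolutelyContinuousOnInterval_intervalIntegral
    (c := c) ?_).mono ?_
  · exact mem_uIcc_of_le (min_le_right _ _) (le_max_right _ _)
  · exact uIcc_subset_uIcc
      (mem_uIcc_of_le ((min_le_left _ _).trans (min_le_left _ _))
        ((le_max_left _ _).trans (le_max_left _ _)))
      (mem_uIcc_of_le ((min_le_left _ _).trans (min_le_right _ _))
        ((le_max_right _ _).trans (le_max_left _ _)))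

lemma comp_neg (hy : LocallyAC y) : LocallyAC fun x => y (-x) := by
  intro a b
  have h := hy (-a) (-b)
  rw [absolutelyContinuousOnInterval_iff] at h ⊢
  intro ε hε
  obtain ⟨δ, hδ, H⟩ := h ε hε
  refine ⟨δ, hδ, fun E hE hsum => H (E.1, fun i => (-(E.2 i).1, -(E.2 i).2)) ⟨fun i hi => ?_, ?_⟩
    ?_⟩
  · have h := hE.1 i hi
    simp only [mem_uIcc, neg_le_neg_iff] at h ⊢
    tauto
  · intro i hi j hj hij
    have h := hE.2 hi hj hij
    -- Reflection does not preserve half-open intervals, but disjointness of two `Ioc` is an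
    -- inequality between endpoints, which is symmetric under negation.
    simp only [Function.onFun, uIoc, Ioc_disjoint_Ioc, max_neg_neg, min_neg_neg,
      neg_le_neg_iff] at h ⊢
    exact h
  · simpa only [dist_neg_neg] using hsum

end LocallyAC

/-! ### Exponential averages and the linear equation -/

section Average

variable {m : ℝ} {F : ℝ → ℝ}

lemma intervalIntegrable_of_integrable_translate (hm : 0 < m)
    (hF : ∀ x, Integrable (fun s => F (x + s)) (expDecay m)) (a b : ℝ) :
    IntervalIntegrable (fun s => Real.exp (-(m * s)) * F s) volume a b := by
  rw [intervalIntegrable_iff]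
  exact (integrableOn_of_integrable_expDecay_translate hm (hF (min a b))).mono_set
    Ioc_subset_Ioi_self

lemma average_translate_eq (hm : 0 < m)
    (hF : ∀ x, Integrable (fun s => F (x + s)) (expDecay m)) (x : ℝ) :
    ∫ s, F (x + s) ∂expDecay m = m * Real.exp (m * x) *
      ((∫ s in Ioi 0, Real.exp (-(m * s)) * F s) -
        ∫ s in (0 : ℝ)..x, Real.exp (-(m * s)) * F s) := by
  rw [integral_expDecay_translate hm]
  congr 1
  rw [eq_sub_iff_add_eq', intervalIntegral.integral_interval_add_Ioi
    (integrableOn_of_integrable_expDecay_translate hm (hF 0))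
    (integrableOn_of_integrable_expDecay_translate hm (hF x))]

lemma locallyAC_average (hm : 0 < m)
    (hF : ∀ x, Integrable (fun s => F (x + s)) (expDecay m)) :
    LocallyAC fun x => ∫ s, F (x + s) ∂expDecay m := by
  rw [funext (average_translate_eq hm hF)]
  refine LocallyAC.mul (ContDiff.locallyAC (by fun_prop)) (LocallyAC.sub
    (y := fun _ => ∫ s in Ioi 0, Real.exp (-(m * s)) * F s)
    (ContDiff.locallyAC contDiff_const)
    (LocallyAC.integral (intervalIntegrable_of_integrable_translate hm hF) 0))

/-- Product rule and Lebesgue differentiation. Consequently `-m⁻¹` times the average solves `y' - m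
y = F`. -/
lemma ae_hasDerivAt_average (hm : 0 < m)
    (hF : ∀ x, Integrable (fun s => F (x + s)) (expDecay m)) :
    ∀ᵐ x, HasDerivAt (fun x => ∫ s, F (x + s) ∂expDecay m)
      (m * (∫ s, F (x + s) ∂expDecay m) - m * F x) x := by
  have hloc : LocallyIntegrable (fun s => Real.exp (-(m * s)) * F s) := by
    intro x
    refine ⟨Ioi (x - 1), Ioi_mem_nhds (by linarith),
      integrableOn_of_integrable_expDecay_translate hm (hF (x - 1))⟩
  filter_upwards [LocallyIntegrable.ae_hasDerivAt_integral hloc] with x hx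
  have h1 : HasDerivAt (fun x => m * Real.exp (m * x)) (m * (Real.exp (m * x) * m)) x := by
    simpa using (((hasDerivAt_id x).const_mul m).exp).const_mul m
  rw [average_translate_eq hm hF x]
  simp_rw [average_translate_eq hm hF]
  refine (h1.mul ((hx 0).const_sub (∫ s in Ioi 0, Real.exp (-(m * s)) * F s))).congr_deriv ?_
  rw [Real.exp_neg]
  field_simp
  ring

end Average

/-! ### Increasing nonlinearities with two-sided slope bounds -/

/-- The bounds `m (x - z) ≤ q x - q z ≤ M (x - z)` for `z ≤ x`. -/
def SlopesIn (q : ℝ → ℝ) (m M : ℝ) : Prop :=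
  ∀ x z, z ≤ x → m * (x - z) ≤ q x - q z ∧ q x - q z ≤ M * (x - z)

namespace SlopesIn

variable {q : ℝ → ℝ} {m M : ℝ}

lemma le (hq : SlopesIn q m M) : m ≤ M := by
  have h := hq 1 0 zero_le_one
  linarith

lemma abs_sub_le (hm : 0 < m) (hq : SlopesIn q m M) (u v : ℝ) :
    |q u - q v| ≤ M * |u - v| := by
  rcases le_total v u with h | h
  · have h' := hq u v h
    have := mul_nonneg hm.le (sub_nonneg.mpr h)
    rw [abs_of_nonneg (sub_nonneg.mpr h), abs_of_nonneg (by linarith)]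
    exact h'.2
  · have h' := hq v u h
    have := mul_nonneg hm.le (sub_nonneg.mpr h)
    rw [abs_sub_comm, abs_sub_comm u, abs_of_nonneg (sub_nonneg.mpr h),
      abs_of_nonneg (by linarith)]
    exact h'.2

lemma abs_residual_sub_le (hq : SlopesIn q m M) (u v : ℝ) :
    |(q u - M * u) - (q v - M * v)| ≤ (M - m) * |u - v| := by
  rcases le_total v u with h | h
  · have h' := hq u v h
    rw [abs_of_nonneg (sub_nonneg.mpr h), abs_le]
    constructor <;> nlinarith
  · have h' := hq v u h
    rw [abs_sub_comm u, abs_of_nonneg (sub_nonneg.mpr h), abs_le]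
    constructor <;> nlinarith

lemma continuous (hm : 0 < m) (hq : SlopesIn q m M) : Continuous q :=
  (LipschitzWith.of_dist_le_mul (K := M.toNNReal) fun u v => by
    rw [Real.coe_toNNReal _ (hm.le.trans hq.le)]
    exact hq.abs_sub_le hm u v).continuous

end SlopesIn

/-! ### Comparison of solutions and existence of a bounded one -/

section Equation

variable {q g g₁ g₂ y₁ y₂ : ℝ → ℝ} {m M : ℝ}

lemma le_deriv_abs {w : ℝ → ℝ} {x a G : ℝ} (hw : HasDerivAt w (a + G) x)
    (hpos : 0 ≤ w x → m * w x ≤ a) (hneg : w x ≤ 0 → a ≤ m * w x) :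
    m * |w x| - |G| ≤ deriv (fun s => |w s|) x := by
  rcases lt_trichotomy (w x) 0 with h | h | h
  · have hd : HasDerivAt (fun s => |w s|) (-1 * (a + G)) x := (hasDerivAt_abs_neg h).comp x hw
    rw [hd.deriv, abs_of_neg h]
    linarith [hneg h.le, neg_abs_le G, le_abs_self G]
  · have hmin : IsLocalMin (fun s => |w s|) x :=
      Filter.Eventually.of_forall fun s => by simp [h]
    rw [hmin.deriv_eq_zero, h]
    simp
  · have hd : HasDerivAt (fun s => |w s|) (1 * (a + G)) x := (hasDerivAt_abs_pos h).comp x hw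
    rw [hd.deriv, abs_of_pos h]
    linarith [hpos h.le, neg_abs_le G, le_abs_self G]

lemma IsSolution.ae_hasDerivAt_sub (h₁ : IsSolution q g₁ y₁) (h₂ : IsSolution q g₂ y₂) :
    ∀ᵐ x, HasDerivAt (y₁ - y₂) ((q (y₁ x) - q (y₂ x)) + (g₁ - g₂) x) x := by
  filter_upwards [h₁.1.ae_differentiableAt, h₂.1.ae_differentiableAt, h₁.2, h₂.2]
    with x d₁ d₂ e₁ e₂
  refine (d₁.hasDerivAt.sub d₂.hasDerivAt).congr_deriv ?_
  rw [Pi.sub_apply, ← e₁, ← e₂]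
  ring

/-- Two solutions of an equation with expanding nonlinearity drift apart exponentially, up to the
difference of the right-hand sides. -/
lemma IsSolution.exp_mul_abs_sub_le (hq : SlopesIn q m M)
    (h₁ : IsSolution q g₁ y₁) (h₂ : IsSolution q g₂ y₂)
    (hg : ∀ a b, IntervalIntegrable
      (fun s => Real.exp (-(m * s)) * |(g₁ - g₂) s|) volume a b) {x t : ℝ} (hxt : x ≤ t) :
    Real.exp (-(m * x)) * |(y₁ - y₂) x| ≤ Real.exp (-(m * t)) * |(y₁ - y₂) t| +
      ∫ s in x..t, Real.exp (-(m * s)) * |(g₁ - g₂) s| := by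
  have hac : LocallyAC fun s => |(y₁ - y₂) s| := (h₁.1.sub h₂.1).abs
  have hu : LocallyAC fun s => Real.exp (-(m * s)) * |(y₁ - y₂) s| :=
    LocallyAC.mul (ContDiff.locallyAC (by fun_prop)) hac
  have hint := (hu x t).integral_deriv_eq_sub
  have hle : ∫ s in x..t, -(Real.exp (-(m * s)) * |(g₁ - g₂) s|) ≤
      ∫ s in x..t, deriv (fun s => Real.exp (-(m * s)) * |(y₁ - y₂) s|) s := by
    refine intervalIntegral.integral_mono_ae hxt (hg x t).neg (hu x t).intervalIntegrable_deriv ?_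
    filter_upwards [hac.ae_differentiableAt, h₁.ae_hasDerivAt_sub h₂] with s hs hd
    have hE : HasDerivAt (fun s => Real.exp (-(m * s))) (Real.exp (-(m * s)) * -m) s := by
      simpa using ((hasDerivAt_id s).const_mul m).neg.exp
    have hab : m * |(y₁ - y₂) s| - |(g₁ - g₂) s| ≤ deriv (fun s => |(y₁ - y₂) s|) s := by
      refine le_deriv_abs hd (fun h => (hq _ _ (sub_nonneg.mp h)).1) fun h => ?_
      have := (hq _ _ (sub_nonpos.mp h)).1
      simp only [Pi.sub_apply]
      linarith
    rw [(hE.fun_mul hs.hasDerivAt).deriv]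
    have := mul_le_mul_of_nonneg_left hab (Real.exp_pos (-(m * s))).le
    linarith
  rw [hint, intervalIntegral.integral_neg] at hle
  linarith

/-- The boundary term at `t` is kept because it is removed in two ways: by `t → ∞` for bounded
solutions, and by a well-chosen `t` for solutions in `L(N)`. -/
lemma IsSolution.mul_abs_sub_le (hm : 0 < m) (hq : SlopesIn q m M)
    (h₁ : IsSolution q g₁ y₁) (h₂ : IsSolution q g₂ y₂)
    (hg : ∀ x, Integrable (fun s => (g₁ - g₂) (x + s)) (expDecay m)) {x t : ℝ} (hxt : x ≤ t) :
    m * |(y₁ - y₂) x| ≤ m * (Real.exp (m * (x - t)) * |(y₁ - y₂) t|) +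
      ∫ s, |(g₁ - g₂) (x + s)| ∂expDecay m := by
  have hint := fun x => integrableOn_of_integrable_expDecay_translate
    (f := fun s => |(g₁ - g₂) s|) hm (hg x).abs
  have h := h₁.exp_mul_abs_sub_le hq h₂
    (intervalIntegrable_of_integrable_translate (F := fun s => |(g₁ - g₂) s|) hm
      fun x => (hg x).abs) hxt
  rw [integral_expDecay_translate hm (fun s => |(g₁ - g₂) s|)]
  have hle : ∫ s in x..t, Real.exp (-(m * s)) * |(g₁ - g₂) s| ≤
      ∫ s in Ioi x, Real.exp (-(m * s)) * |(g₁ - g₂) s| := by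
    rw [intervalIntegral.integral_of_le hxt]
    exact setIntegral_mono_set (hint x)
      (Filter.Eventually.of_forall fun s => by positivity)
      (Filter.Eventually.of_forall Ioc_subset_Ioi_self)
  have h' := mul_le_mul_of_nonneg_left (h.trans (add_le_add_right hle _))
    (mul_pos hm (Real.exp_pos (m * x))).le
  have e : Real.exp (m * x) * Real.exp (-(m * x)) = 1 := by
    rw [← Real.exp_add]; simp
  have e' : Real.exp (m * (x - t)) = Real.exp (m * x) * Real.exp (-(m * t)) := by
    rw [← Real.exp_add]; ring_nf
  rw [e']
  calc m * |(y₁ - y₂) x| = m * (Real.exp (m * x) * Real.exp (-(m * x))) * |(y₁ - y₂) x| := by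
        rw [e, mul_one]
    _ = m * Real.exp (m * x) * (Real.exp (-(m * x)) * |(y₁ - y₂) x|) := by ring
    _ ≤ _ := h'
    _ = _ := by ring

lemma IsSolution.mul_abs_sub_le_of_bounded (hm : 0 < m) (hq : SlopesIn q m M)
    (h₁ : IsSolution q g₁ y₁) (h₂ : IsSolution q g₂ y₂)
    (hg : ∀ x, Integrable (fun s => (g₁ - g₂) (x + s)) (expDecay m))
    {B₁ B₂ : ℝ} (hB₁ : ∀ x, |y₁ x| ≤ B₁) (hB₂ : ∀ x, |y₂ x| ≤ B₂) (x : ℝ) :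
    m * |(y₁ - y₂) x| ≤ ∫ s, |(g₁ - g₂) (x + s)| ∂expDecay m := by
  have hlim : Filter.Tendsto (fun t => m * (Real.exp (m * (x - t)) * (B₁ + B₂)) +
      ∫ s, |(g₁ - g₂) (x + s)| ∂expDecay m) Filter.atTop
      (nhds (m * (0 * (B₁ + B₂)) + ∫ s, |(g₁ - g₂) (x + s)| ∂expDecay m)) := by
    refine (((Real.tendsto_exp_atBot.comp ?_).mul_const _).const_mul m).add_const _
    exact (Filter.tendsto_atBot_add_const_left _ x Filter.tendsto_neg_atTop_atBot).const_mul_atBot hm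
  have h := ge_of_tendsto hlim (b := m * |(y₁ - y₂) x|) ?_
  · simpa using h
  · filter_upwards [Filter.eventually_ge_atTop x] with t ht
    refine (h₁.mul_abs_sub_le hm hq h₂ hg ht).trans ?_
    gcongr
    exact (abs_sub _ _).trans (add_le_add (hB₁ t) (hB₂ t))

lemma isSolution_zero (hq0 : q 0 = 0) : IsSolution q 0 0 :=
  ⟨ContDiff.locallyAC contDiff_const, by simp [hq0]⟩

/-- Comparison with the zero solution, with `t ≥ x` chosen so that `|y t| ≤ 1`; the averages of
`|g|` are bounded uniformly in `x`. -/
lemma IsSolution.exists_bound {N : ℝ → ℝ} (hN : IsOrliczFunction N) (hm : 0 < m)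
    (hq : SlopesIn q m M) (hq0 : q 0 = 0) {y : ℝ → ℝ} (hg : MemOrlicz N g)
    (h : IsSolution q g y) (hy : orliczNorm N y < ∞) : ∃ B, ∀ x, |y x| ≤ B := by
  obtain ⟨k, hk0, hk⟩ := exists_modular_le_one hg.2
  refine ⟨m⁻¹ * (m + (k + k * (N 1)⁻¹ * m)), fun x => ?_⟩
  obtain ⟨t, hxt, ht⟩ := exists_abs_le_one hN hy x
  have hle := h.mul_abs_sub_le hm hq (isSolution_zero hq0)
    (by simpa using integrable_translate hN hm hg.1 hk0 hk) hxt
  simp only [sub_zero] at hle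
  have hexp : Real.exp (m * (x - t)) * |y t| ≤ 1 :=
    mul_le_one₀ (Real.exp_le_one_iff.mpr (mul_nonpos_of_nonneg_of_nonpos hm.le (by linarith)))
      (abs_nonneg _) ht
  have := integral_abs_translate_le hN hm hg.1 hk0 hk x
  have := mul_le_mul_of_nonneg_left hexp hm.le
  rw [le_inv_mul_iff₀ hm]
  linarith

/-- Existence of a bounded solution, by the contraction principle in the bounded continuous
functions. -/
lemma exists_bounded_solution (hm : 0 < m) (hq : SlopesIn q m M) (hq0 : q 0 = 0)
    (hg : ∀ x, Integrable (fun s => g (x + s)) (expDecay M)) {D : ℝ}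
    (hD : ∀ x, ∫ s, |g (x + s)| ∂expDecay M ≤ D) :
    ∃ y, IsSolution q g y ∧ ∃ B, ∀ x, |y x| ≤ B := by
  have hM : 0 < M := hm.trans_le hq.le
  have hprob := isProbabilityMeasure_expDecay hM
  have hqc := hq.continuous hm
  -- Removing the largest slope `M`, rather than `m`, is what makes the ratio `(M - m) / M` less
  -- than `1`: the kernel of rate `M` contributes the factor `M⁻¹`.
  let p : ℝ → ℝ := fun u => q u - M * u
  have hpc : Continuous p := by fun_prop
  have hp (y : BoundedContinuousFunction ℝ ℝ) (u : ℝ) : ‖p (y u)‖ ≤ (M - m) * ‖y‖ := by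
    have h := hq.abs_residual_sub_le (y u) 0
    simp only [hq0, mul_zero, sub_zero] at h
    exact h.trans (mul_le_mul_of_nonneg_left (y.norm_coe_le_norm u) (sub_nonneg.mpr hq.le))
  have hpi (y : BoundedContinuousFunction ℝ ℝ) (x : ℝ) :
      Integrable (fun s => p (y (x + s))) (expDecay M) :=
    Integrable.of_bound (by fun_prop) _ (Filter.Eventually.of_forall fun s => hp y (x + s))
  let F : BoundedContinuousFunction ℝ ℝ → ℝ → ℝ := fun y s => p (y s) + g s
  have hF (y : BoundedContinuousFunction ℝ ℝ) (x : ℝ) :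
      Integrable (fun s => F y (x + s)) (expDecay M) := (hpi y x).add (hg x)
  have hFb (y : BoundedContinuousFunction ℝ ℝ) (x : ℝ) :
      ‖-M⁻¹ * ∫ s, F y (x + s) ∂expDecay M‖ ≤ M⁻¹ * ((M - m) * ‖y‖ + D) := by
    rw [norm_mul, norm_neg, Real.norm_of_nonneg (inv_pos.mpr hM).le]
    gcongr
    have hadd : ∫ s, F y (x + s) ∂expDecay M =
        (∫ s, p (y (x + s)) ∂expDecay M) + ∫ s, g (x + s) ∂expDecay M :=
      integral_add (hpi y x) (hg x)
    rw [hadd]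
    refine (norm_add_le _ _).trans (add_le_add ?_ ?_)
    · simpa using norm_integral_le_of_norm_le_const (μ := expDecay M)
        (Filter.Eventually.of_forall fun s => hp y (x + s))
    · exact (norm_integral_le_integral_norm _).trans (hD x)
  -- `T y` is the bounded solution `u` of `u' - M u = p(y) + g`.
  let T : BoundedContinuousFunction ℝ ℝ → BoundedContinuousFunction ℝ ℝ := fun y =>
    BoundedContinuousFunction.ofNormedAddCommGroup
      (fun x => -M⁻¹ * ∫ s, F y (x + s) ∂expDecay M)
      (continuous_const.mul (locallyAC_average hM (hF y)).continuous) _ (hFb y)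
  have hK : 0 ≤ M⁻¹ * (M - m) := mul_nonneg (inv_pos.mpr hM).le (sub_nonneg.mpr hq.le)
  have hT : ContractingWith (M⁻¹ * (M - m)).toNNReal T := by
    constructor
    · rw [Real.toNNReal_lt_one, inv_mul_lt_iff₀ hM]
      linarith
    · refine LipschitzWith.of_dist_le_mul fun y z => ?_
      rw [Real.coe_toNNReal _ hK]
      refine (BoundedContinuousFunction.dist_le (mul_nonneg hK dist_nonneg)).mpr fun x => ?_
      change dist (-M⁻¹ * ∫ s, F y (x + s) ∂expDecay M)
        (-M⁻¹ * ∫ s, F z (x + s) ∂expDecay M) ≤ _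
      rw [Real.dist_eq, ← mul_sub, ← integral_sub (hF y x) (hF z x), abs_mul, abs_neg,
        abs_of_pos (inv_pos.mpr hM), mul_assoc]
      gcongr
      have hb : ∀ᵐ s ∂expDecay M, ‖F y (x + s) - F z (x + s)‖ ≤ (M - m) * dist y z := by
        refine Filter.Eventually.of_forall fun s => ?_
        simp only [F, p, add_sub_add_right_eq_sub]
        exact (hq.abs_residual_sub_le _ _).trans (mul_le_mul_of_nonneg_left
          (y.dist_coe_le_dist (x + s)) (sub_nonneg.mpr hq.le))
      simpa using norm_integral_le_of_norm_le_const hb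
  have hfix : T (hT.fixedPoint T) = hT.fixedPoint T := hT.fixedPoint_isFixedPt
  set y := hT.fixedPoint T
  have hy : (y : ℝ → ℝ) = fun x => -M⁻¹ * ∫ s, F y (x + s) ∂expDecay M := by
    conv_lhs => rw [← hfix]
    rfl
  refine ⟨y, ⟨?_, ?_⟩, ‖y‖, y.norm_coe_le_norm⟩
  · rw [hy]
    exact LocallyAC.mul (ContDiff.locallyAC contDiff_const) (locallyAC_average hM (hF y))
  · filter_upwards [ae_hasDerivAt_average hM (hF y)] with x hx
    have hd := (hx.const_mul (-M⁻¹)).deriv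
    rw [← hy] at hd
    have hyx := congrFun hy x
    rw [hd]
    generalize ∫ s, F y (x + s) ∂expDecay M = I at hyx ⊢
    have : I = -M * y x := by rw [hyx]; field_simp
    rw [this]
    simp only [F, p]
    field_simp
    ring

end Equation

/-! ### Norm estimates and solvability for increasing `q` -/

section Solvable

variable {N q g₁ g₂ y₁ y₂ : ℝ → ℝ} {m M : ℝ}

/-- The triangle inequality at the level of modulars: convexity of `N` with weights `a / (a + b)`
and `b / (a + b)`. -/
lemma lintegral_modular_add_le (hN : IsOrliczFunction N) {f w g : ℝ → ℝ} {a b : ℝ} (ha : 0 < a)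
    (hb : 0 < b) (hw : AEMeasurable w) (hf : ∀ᵐ x, |f x| ≤ |w x| + |g x|)
    (hwa : ∫⁻ x, ENNReal.ofReal (N (|w x| / a)) ≤ 1)
    (hgb : ∫⁻ x, ENNReal.ofReal (N (|g x| / b)) ≤ 1) :
    ∫⁻ x, ENNReal.ofReal (N (|f x| / (a + b))) ≤ 1 := by
  have hab : 0 < a + b := add_pos ha hb
  have hsum : a / (a + b) + b / (a + b) = 1 := by field_simp
  calc _ ≤ ∫⁻ x, (ENNReal.ofReal (a / (a + b)) * ENNReal.ofReal (N (|w x| / a)) +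
          ENNReal.ofReal (b / (a + b)) * ENNReal.ofReal (N (|g x| / b))) := by
        refine lintegral_mono_ae ?_
        filter_upwards [hf] with x hx
        rw [← ENNReal.ofReal_mul (by positivity), ← ENNReal.ofReal_mul (by positivity),
          ← ENNReal.ofReal_add (mul_nonneg (by positivity) (hN.nonneg _))
            (mul_nonneg (by positivity) (hN.nonneg _))]
        refine ENNReal.ofReal_le_ofReal ((hN.mono (v := (|w x| + |g x|) / (a + b))
          (by positivity) (by gcongr)).trans ?_)
        have hc := hN.convex.2 (mem_univ (|w x| / a)) (mem_univ (|g x| / b))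
          (div_pos ha hab).le (div_pos hb hab).le hsum
        simp only [smul_eq_mul] at hc
        convert hc using 2
        field_simp
    _ = ENNReal.ofReal (a / (a + b)) * (∫⁻ x, ENNReal.ofReal (N (|w x| / a))) +
          ENNReal.ofReal (b / (a + b)) * ∫⁻ x, ENNReal.ofReal (N (|g x| / b)) := by
        have hmeas : AEMeasurable fun x => N (|w x| / a) :=
          hN.continuous.measurable.comp_aemeasurable (hw.abs.div_const a)
        rw [lintegral_add_left' (hmeas.ennreal_ofReal.const_mul _),
          lintegral_const_mul' _ _ ENNReal.ofReal_ne_top,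
          lintegral_const_mul' _ _ ENNReal.ofReal_ne_top]
    _ ≤ ENNReal.ofReal (a / (a + b)) * 1 + ENNReal.ofReal (b / (a + b)) * 1 := by gcongr
    _ = 1 := by
        rw [mul_one, mul_one, ← ENNReal.ofReal_add (by positivity) (by positivity), hsum,
          ENNReal.ofReal_one]

/-- For `k` admissible for `g₁ - g₂`, the difference of solutions admits `k / m` and its derivative
`M k / m + k`; the sum gives the constant. Only boundedness of the solutions is assumed, so the
estimate also places the fixed point of the contraction in `W₁(L(N))`. -/
lemma orliczSobolevNorm_sub_le (hN : IsOrliczFunction N) (hm : 0 < m) (hq : SlopesIn q m M)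
    (hg : AEMeasurable (g₁ - g₂)) (h₁ : IsSolution q g₁ y₁) (h₂ : IsSolution q g₂ y₂)
    {B₁ B₂ : ℝ} (hB₁ : ∀ x, |y₁ x| ≤ B₁) (hB₂ : ∀ x, |y₂ x| ≤ B₂) :
    orliczSobolevNorm N (y₁ - y₂) ≤
      ENNReal.ofReal ((M + 1) / m + 1) * orliczNorm N (g₁ - g₂) := by
  have hM : 0 < M := hm.trans_le hq.le
  refine le_mul_orliczNorm (by positivity) fun k hk0 hk => ?_
  have hw : ∫⁻ x, ENNReal.ofReal (N (|(y₁ - y₂) x| / (k / m))) ≤ 1 := by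
    refine (lintegral_mono fun x => ENNReal.ofReal_le_ofReal ?_).trans
      (lintegral_modular_average_le hN hm hg hk0 hk)
    refine hN.mono (by positivity) ?_
    have := h₁.mul_abs_sub_le_of_bounded hm hq h₂ (integrable_translate hN hm hg hk0 hk) hB₁ hB₂ x
    rw [div_div_eq_mul_div, mul_comm]
    gcongr
  have hMw : ∫⁻ x, ENNReal.ofReal (N (|M * (y₁ - y₂) x| / (M * (k / m)))) ≤ 1 := by
    simp_rw [abs_mul, abs_of_pos hM, mul_div_mul_left _ _ hM.ne']
    exact hw
  have hd : ∫⁻ x, ENNReal.ofReal (N (|deriv (y₁ - y₂) x| / (M * (k / m) + k))) ≤ 1 := by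
    refine lintegral_modular_add_le hN (by positivity) hk0
      ((h₁.1.sub h₂.1).continuous.measurable.const_mul M).aemeasurable ?_ hMw hk
    filter_upwards [h₁.ae_hasDerivAt_sub h₂] with x hx
    rw [hx.deriv, abs_mul, abs_of_pos hM]
    exact (abs_add_le _ _).trans (add_le_add_left (hq.abs_sub_le hm _ _) _)
  refine (add_le_add (orliczNorm_le (by positivity) hd) (orliczNorm_le (by positivity) hw)).trans ?_
  rw [← ENNReal.ofReal_add (by positivity) (by positivity)]
  refine ENNReal.ofReal_le_ofReal (le_of_eq ?_)
  field_simp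
  ring

lemma SlopesIn.lipschitzCorrectlySolvable (hN : IsOrliczFunction N) (hm : 0 < m)
    (hq : SlopesIn q m M) (hq0 : q 0 = 0) :
    LipschitzCorrectlySolvable q N ((M + 1) / m + 1) := by
  have hM : 0 < M := hm.trans_le hq.le
  have hfin (y : ℝ → ℝ) (hy : MemOrliczSobolev N y) : orliczNorm N y < ∞ :=
    (le_add_self).trans_lt hy.2
  have hzero {g y : ℝ → ℝ} (hg : MemOrlicz N g) (hy : IsSolution q g y) {B : ℝ}
      (hB : ∀ x, |y x| ≤ B) : orliczSobolevNorm N y ≤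
      ENNReal.ofReal ((M + 1) / m + 1) * orliczNorm N g := by
    have := orliczSobolevNorm_sub_le hN hm hq (g₂ := 0) (by simpa using hg.1) hy
      (isSolution_zero hq0) hB (B₂ := 0) (by simp)
    simpa using this
  constructor
  · intro g hg
    obtain ⟨k, hk0, hk⟩ := exists_modular_le_one hg.2
    obtain ⟨y, hy, B, hB⟩ := exists_bounded_solution hm hq hq0
      (integrable_translate hN hM hg.1 hk0 hk) (integral_abs_translate_le hN hM hg.1 hk0 hk)
    refine ⟨y, hy, ⟨hy.1, (hzero hg hy hB).trans_lt (ENNReal.mul_lt_top ENNReal.ofReal_lt_top hg.2)⟩,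
      fun z hz hzN => ?_⟩
    obtain ⟨B', hB'⟩ := hz.exists_bound hN hm hq hq0 hg hzN.2
    funext x
    have h := hz.mul_abs_sub_le_of_bounded hm hq hy (by simp) hB' hB x
    simp only [sub_self, abs_zero, integral_zero, Pi.sub_apply] at h
    have : |z x - y x| ≤ 0 := nonpos_of_mul_nonpos_right h hm
    exact sub_eq_zero.mp (abs_nonpos_iff.mp this)
  · intro g y hg hy hyN
    obtain ⟨B, hB⟩ := hy.exists_bound hN hm hq hq0 hg (hfin y hyN)
    exact hzero hg hy hB
  · intro g₁ g₂ y₁ y₂ hg₁ hg₂ h₁ hy₁ h₂ hy₂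
    obtain ⟨B₁, hB₁⟩ := h₁.exists_bound hN hm hq hq0 hg₁ (hfin _ hy₁)
    obtain ⟨B₂, hB₂⟩ := h₂.exists_bound hN hm hq hq0 hg₂ (hfin _ hy₂)
    exact orliczSobolevNorm_sub_le hN hm hq (hg₁.1.sub hg₂.1) h₁ h₂ hB₁ hB₂

end Solvable

/-! ### Reflection and the decreasing case -/

section Reflection

variable {N q : ℝ → ℝ}

lemma orliczNorm_comp_neg (N f : ℝ → ℝ) : orliczNorm N (fun x => f (-x)) = orliczNorm N f := by
  unfold orliczNorm
  congr! 5 with k hk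
  rw [lintegral_neg_eq_self (fun x => ENNReal.ofReal (N (|f x| / k)))]

lemma orliczNorm_neg_comp_neg (N f : ℝ → ℝ) :
    orliczNorm N (fun x => -f (-x)) = orliczNorm N f := by
  rw [← orliczNorm_comp_neg N f]
  simp only [orliczNorm, abs_neg]

lemma orliczSobolevNorm_comp_neg (N y : ℝ → ℝ) :
    orliczSobolevNorm N (fun x => y (-x)) = orliczSobolevNorm N y := by
  have h : deriv (fun x => y (-x)) = fun x => -deriv y (-x) := funext fun x => deriv_comp_neg y x
  rw [orliczSobolevNorm, h, orliczNorm_comp_neg, orliczNorm_neg_comp_neg, orliczSobolevNorm]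

lemma MemOrlicz.comp_neg {f : ℝ → ℝ} (hf : MemOrlicz N f) : MemOrlicz N fun x => f (-x) :=
  ⟨hf.1.comp_quasiMeasurePreserving (Measure.measurePreserving_neg volume).quasiMeasurePreserving,
    (orliczNorm_comp_neg N f).trans_lt hf.2⟩

lemma MemOrlicz.neg_comp_neg {f : ℝ → ℝ} (hf : MemOrlicz N f) : MemOrlicz N fun x => -f (-x) :=
  ⟨hf.comp_neg.1.neg, (orliczNorm_neg_comp_neg N f).trans_lt hf.2⟩

lemma MemOrliczSobolev.comp_neg {y : ℝ → ℝ} (hy : MemOrliczSobolev N y) :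
    MemOrliczSobolev N fun x => y (-x) :=
  ⟨hy.1.comp_neg, (orliczSobolevNorm_comp_neg N y).trans_lt hy.2⟩

lemma IsSolution.comp_neg {g y : ℝ → ℝ} (h : IsSolution q g y) :
    IsSolution (fun u => -q u) (fun x => -g (-x)) (fun x => y (-x)) := by
  refine ⟨h.1.comp_neg, ?_⟩
  filter_upwards [(Measure.measurePreserving_neg volume).quasiMeasurePreserving.ae h.2] with x hx
  rw [deriv_comp_neg, ← hx]
  ring

/-- If `y` solves `y' - q(y) = g`, then `y(-x)` solves the equation with `-q` and right-hand side
`-g(-x)`. This correspondence is involutive and preserves all the norms, hence also `C`. -/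
lemma LipschitzCorrectlySolvable.of_neg {C : ℝ}
    (h : LipschitzCorrectlySolvable (fun u => -q u) N C) : LipschitzCorrectlySolvable q N C := by
  constructor
  · intro g hg
    obtain ⟨y, hy, hyN, huniq⟩ := h.existsUnique _ hg.neg_comp_neg
    refine ⟨fun x => y (-x), by simpa using hy.comp_neg, hyN.comp_neg, fun z hz hzN => ?_⟩
    have := huniq _ hz.comp_neg hzN.comp_neg
    funext x
    simpa using congrFun this (-x)
  · intro g y hg hy hyN
    have := h.bound _ _ hg.neg_comp_neg hy.comp_neg hyN.comp_neg
    rwa [orliczSobolevNorm_comp_neg, orliczNorm_neg_comp_neg] at this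
  · intro g₁ g₂ y₁ y₂ hg₁ hg₂ h₁ hy₁ h₂ hy₂
    have := h.lipschitz _ _ _ _ hg₁.neg_comp_neg hg₂.neg_comp_neg h₁.comp_neg hy₁.comp_neg
      h₂.comp_neg hy₂.comp_neg
    rw [← orliczSobolevNorm_comp_neg N (y₁ - y₂), ← orliczNorm_neg_comp_neg N (g₁ - g₂)]
    have e : (fun x => -(g₁ - g₂) (-x)) = (fun x => -g₁ (-x)) - fun x => -g₂ (-x) := by
      funext x
      simp only [Pi.sub_apply]
      ring
    rw [e]
    exact this

end Reflection

/-! ### Monotonicity dichotomy and the theorem -/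

/-- A function whose slopes have modulus in `[m, M]` with `0 < m` is strictly monotone, so either
it or its negative has all its slopes in `[m, M]`. -/
lemma slopesIn_or_slopesIn_neg {q : ℝ → ℝ} {m M : ℝ} (hm : 0 < m) (hlow : IsGLB (slopes q) m)
    (hup : IsLUB (slopes q) M) : SlopesIn q m M ∨ SlopesIn (fun u => -q u) m M := by
  have hb (x z : ℝ) : m * |x - z| ≤ |q x - q z| ∧ |q x - q z| ≤ M * |x - z| := by
    rcases eq_or_ne x z with rfl | h
    · simp
    · have hpos : 0 < |x - z| := abs_pos.mpr (sub_ne_zero.mpr h)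
      exact ⟨(le_div_iff₀ hpos).mp (hlow.1 ⟨x, z, h, rfl⟩),
        (div_le_iff₀ hpos).mp (hup.1 ⟨x, z, h, rfl⟩)⟩
  have hcont : Continuous q := by
    refine (LipschitzWith.of_dist_le_mul (K := M.toNNReal) fun u v => ?_).continuous
    exact (hb u v).2.trans (mul_le_mul_of_nonneg_right (Real.le_coe_toNNReal M) (abs_nonneg _))
  have hinj : Function.Injective q := by
    intro x z h
    have := (hb x z).1
    rw [h, sub_self, abs_zero] at this
    exact sub_eq_zero.mp (abs_nonpos_iff.mp (nonpos_of_mul_nonpos_right this hm))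
  refine (hcont.strictMono_of_inj hinj).imp (fun h x z hzx => ?_) fun h x z hzx => ?_
  · have := hb x z
    rwa [abs_of_nonneg (sub_nonneg.mpr hzx), abs_of_nonneg (sub_nonneg.mpr (h.monotone hzx))]
      at this
  · have := hb x z
    rw [abs_of_nonneg (sub_nonneg.mpr hzx), abs_of_nonpos (sub_nonpos.mpr (h.antitone hzx))] at this
    rwa [neg_sub_neg, ← neg_sub (q x)]

theorem theorem1 (N : ℝ → ℝ) (hN : IsDeltaClass N ∨ IsExponentialOrlicz N)
    (m M : ℝ) (hm : 0 < m) :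
    ∃ C : ℝ, 0 < C ∧ ∀ q : ℝ → ℝ, q 0 = 0 → IsGLB (slopes q) m → IsLUB (slopes q) M →
      LipschitzCorrectlySolvable q N C := by
  have hN' : IsOrliczFunction N := hN.elim IsDeltaClass.orlicz And.left
  -- For `M ≤ 0` no `q` qualifies, since the slope bounds force `m ≤ M`; any positive constant
  -- serves.
  rcases le_or_gt M 0 with hM | hM
  · refine ⟨1, one_pos, fun q _ hlow hup => ?_⟩
    have := (slopesIn_or_slopesIn_neg hm hlow hup).elim SlopesIn.le SlopesIn.le
    linarith
  · refine ⟨(M + 1) / m + 1, by positivity, fun q hq0 hlow hup => ?_⟩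
    rcases slopesIn_or_slopesIn_neg hm hlow hup with h | h
    · exact h.lipschitzCorrectlySolvable hN' hm hq0
    · exact (h.lipschitzCorrectlySolvable hN' hm (by simp [hq0])).of_neg
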